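/- Let $\mu$ be a Borel probability measure on $\mathbb{R}^d$. Let $X_n=(x_1,\dots,x_n)$ be a sample of $n$ independent random points distributed according to $\mu$, and let $P_n^\mu$ be the convex hull of these points. Let $\breve P_n^\mu$ be the interior of $P_n^\mu$ and let $\bar f_0(X_n^\mu)$ be the number of indices $i$ such that $x_i$ lies on the boundary of $P_n^\mu$ (so coincident points are counted with multiplicity); interior and boundary are taken in $\mathbb{R}^d$, not relative to the affine hull. For real $t$ let \[ W_t^\mu=\{x\in\mathbb{R}^d:\ \text{there is a closed half-space } h \text{ with } x\in h \text{ and } \mu(h)\le t\}, \] and let $\bar w^\mu(t)=\mu\bigl(\overline{W_t^\mu}\bigr)$ be the measure of its closure. (i) For every $d$ there is a sequence $\varepsilon_d(n)$ with $\varepsilon_d(n)\to 0$ as $n\to\infty$ such that for every probability measure $\mu$ on $\mathbb{R}^d$ and every $n\ge 2$ \[ \tfrac14\,\bar w^\mu\bigl(\tfrac1n\bigr)\le \mathbb{E}\bigl[1-\mu(\breve P_n^\mu)\bigr]\le \bar w^\mu\bigl((d+2)\tfrac{\ln n}{n}\bigr)+\tfrac{\varepsilon_d(n)}{n} \] and \[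 \tfrac1e\, n\,\bar w^\mu\bigl(\tfrac1n\bigr)\le \mathbb{E}\bigl[\bar f_0(X_n^\mu)\bigr]\le n\,\bar w^\mu\bigl((d+2)\tfrac{\ln n}{n}\bigr)+\varepsilon_d(n). \] (ii) There is a probability measure $\nu$ on $\mathbb{R}^2$ without atoms (every single point has measure $0$) such that, for infinitely many $n$, both \[ \mathbb{E}\bigl[1-\nu(\breve P_n^\nu)\bigr]>\tfrac12\,\bar w^\nu\bigl(\tfrac{\log_2 n}{n}\bigr) \quad\text{and}\quad \mathbb{E}\bigl[\bar f_0(X_n^\nu)\bigr]>\tfrac12\, n\,\bar w^\nu\bigl(\tfrac{\log_2 n}{n}\bigr). \] -/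

import Mathlib

open MeasureTheory Filter Topology

/-- A closed (affine) half-space of `ℝ^d`: a set `{x | ⟪u, x⟫ ≤ c}` with `u ≠ 0`. -/
def IsClosedHalfspace {d : ℕ} (h : Set (EuclideanSpace ℝ (Fin d))) : Prop :=
  ∃ (u : EuclideanSpace ℝ (Fin d)) (c : ℝ), u ≠ 0 ∧ h = {x | inner ℝ u x ≤ c}

/-- The wet part `W_t^μ`: the points that lie in some half-space of `μ`-measure at most `t`. -/
def wetPart {d : ℕ} (μ : Measure (EuclideanSpace ℝ (Fin d))) (t : ℝ) :
    Set (EuclideanSpace ℝ (Fin d)) :=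
  {x | ∃ h : Set (EuclideanSpace ℝ (Fin d)), IsClosedHalfspace h ∧ x ∈ h ∧ μ.real h ≤ t}

/-- The `μ`-measure of the closure of the wet part. -/
noncomputable def closedWetMeasure {d : ℕ} (μ : Measure (EuclideanSpace ℝ (Fin d))) (t : ℝ) : ℝ :=
  μ.real (closure (wetPart μ t))

/-- The joint law of `n` independent random points, each distributed according to `μ`. -/
noncomputable def sampleLaw {d : ℕ} (μ : Measure (EuclideanSpace ℝ (Fin d))) (n : ℕ) :
    Measure (Fin n → EuclideanSpace ℝ (Fin d)) :=
  Measure.pi fun _ => μ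

/-- The polytope spanned by the sample points `x 0, …, x (n - 1)`. -/
def samplePolytope {d n : ℕ} (x : Fin n → EuclideanSpace ℝ (Fin d)) :
    Set (EuclideanSpace ℝ (Fin d)) :=
  convexHull ℝ (Set.range x)

/-- `1 - μ(int P)` for the polytope `P` of the sample `x`; the interior is taken in `ℝ^d`. -/
noncomputable def missedMass {d n : ℕ} (μ : Measure (EuclideanSpace ℝ (Fin d)))
    (x : Fin n → EuclideanSpace ℝ (Fin d)) : ℝ :=
  1 - μ.real (interior (samplePolytope x))

/-- The number of sample points on the boundary, taken in `ℝ^d`, of their convex hull. Indices are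
counted, so coincident sample points are counted with multiplicity. -/
noncomputable def boundaryCount {d n : ℕ} (x : Fin n → EuclideanSpace ℝ (Fin d)) : ℕ :=
  {i : Fin n | x i ∈ frontier (samplePolytope x)}.ncard

/-- The expectation of `1 - μ(int P_n)`. -/
noncomputable def expectedMissedMass {d : ℕ} (μ : Measure (EuclideanSpace ℝ (Fin d))) (n : ℕ) : ℝ :=
  ∫ x, missedMass μ x ∂(sampleLaw μ n)

/-- The expected number of points of an `n`-point sample on the boundary of their hull. -/
noncomputable def expectedBoundaryCount {d : ℕ} (μ : Measure (EuclideanSpace ℝ (Fin d)))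
    (n : ℕ) : ℝ :=
  ∫ x, (boundaryCount x : ℝ) ∂(sampleLaw μ n)

/-! Let p_m(z) be the probability that z is not interior to the hull of m sample points (z escapes).
Fubini gives E[1 - μ(int P_n)] = ∫ p_n dμ, and singling out one sample point gives E[f̄_0] = n ∫
p_{n-1} dμ. So (i) amounts to two-sided bounds on ∫ p_m dμ.

Lower bound: if z lies in a half-space of measure at most t ≤ 1, the sample misses that half-space
with probability at least (1-t)^m, and then z escapes. Escaping is a closed condition, so the bound
passes to the closure of the wet part (`le_escapeProb_of_mem_closure`).

Upper bound: off that closure, every closed half-space with z on its boundary has measure below 1 -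
t. If z escapes, the directions u with ⟪u, x_i - z⟫ ≥ 0 form a nonzero cone; cut by a cube, it has a
nonzero vertex determined by at most d of the x_i (`exists_coneVertex`). Once these are fixed, the
other points are still independent and must all lie in one such half-space. A union bound over the
possible vertices gives p_m(z) ≤ (3(m+d))^d e^{-t(m-d)} for m ≥ d. With t = (d+2) ln n / n this is
O(n^{-2}): d powers of n pay for the union bound, one for the factor n in E[f̄_0], one for
convergence to 0.

For (ii), put mass on circles of radius 4^k, those from the k-th on (k ≥ 1) having mass q_k =
2^{-3^k}, so q_{k+1} = q_k^3, and take n = q_k^{-2}. Since n q_{k+1} = q_k is small, the sample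
rarely goes beyond circle k, so points of norm at least 4^k usually escape
(`le_integral_escapeProb_ringMeasure`). Yet log_2 n / n is far below q_k, while a half-space meeting
the disc of radius 4^k/2 takes a fixed share of circle k (`le_ringMeasure_real_halfspace`). Hence
the closed wet part has measure at most q_k. -/

/-! ### Supporting half-spaces and the interior of the hull -/

/-- The pairs `(x, z)` such that some closed half-space with `z` on its boundary contains all the
points `x i`. -/
def supportedPairs (d n : ℕ) :
    Set ((Fin n → EuclideanSpace ℝ (Fin d)) × EuclideanSpace ℝ (Fin d)) :=
  {p | ∃ u : EuclideanSpace ℝ (Fin d), ‖u‖ = 1 ∧ ∀ i, 0 ≤ inner ℝ u (p.1 i - p.2)}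

theorem mem_supportedPairs_of_ne_zero {d n : ℕ} {x : Fin n → EuclideanSpace ℝ (Fin d)}
    {z u : EuclideanSpace ℝ (Fin d)} (hu : u ≠ 0) (h : ∀ i, 0 ≤ inner ℝ u (x i - z)) :
    (x, z) ∈ supportedPairs d n := by
  refine ⟨(‖u‖⁻¹ : ℝ) • u, ?_, fun i => ?_⟩
  · rw [norm_smul, norm_inv, norm_norm, inv_mul_cancel₀ (norm_ne_zero_iff.2 hu)]
  · rw [real_inner_smul_left]
    exact mul_nonneg (by positivity) (h i)

/-- A projection along the compact unit sphere of directions is a closed map; this is why directions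
are normalised. -/
theorem isClosed_supportedPairs (d n : ℕ) : IsClosed (supportedPairs d n) := by
  have hK : CompactSpace (Metric.sphere (0 : EuclideanSpace ℝ (Fin d)) 1) :=
    isCompact_iff_compactSpace.1 (isCompact_sphere _ _)
  have hS : supportedPairs d n = Prod.snd ''
      {q : Metric.sphere (0 : EuclideanSpace ℝ (Fin d)) 1 ×
        ((Fin n → EuclideanSpace ℝ (Fin d)) × EuclideanSpace ℝ (Fin d)) |
        ∀ i, 0 ≤ inner ℝ (q.1 : EuclideanSpace ℝ (Fin d)) (q.2.1 i - q.2.2)} := by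
    ext p
    constructor
    · rintro ⟨u, hu, h⟩
      exact ⟨(⟨u, by simpa using hu⟩, p), h, rfl⟩
    · rintro ⟨⟨u, p'⟩, h, rfl⟩
      exact ⟨u, by simp, h⟩
  rw [hS]
  apply isClosedMap_snd_of_compactSpace
  simp only [Set.ofPred_forall]
  refine isClosed_iInter fun i => isClosed_le continuous_const ?_
  fun_prop

theorem measurableSet_supportedPairs (d n : ℕ) : MeasurableSet (supportedPairs d n) :=
  (isClosed_supportedPairs d n).measurableSet

/-- Hahn–Banach supports points off the hull, and closedness extends this to the closure of the
complement, that is, to the complement of the interior. Flat hulls need no separate treatment. -/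
theorem notMem_interior_samplePolytope_iff {d n : ℕ} (hn : 0 < n)
    (x : Fin n → EuclideanSpace ℝ (Fin d)) (z : EuclideanSpace ℝ (Fin d)) :
    z ∉ interior (samplePolytope x) ↔ (x, z) ∈ supportedPairs d n := by
  constructor
  · intro hz
    have hcl : IsClosed {z | (x, z) ∈ supportedPairs d n} :=
      (isClosed_supportedPairs d n).preimage (by fun_prop : Continuous fun z => (x, z))
    have hsub : (samplePolytope x)ᶜ ⊆ {z | (x, z) ∈ supportedPairs d n} := by
      intro w hw
      have hc : IsClosed (samplePolytope x) :=
        ((Set.finite_range x).isCompact_convexHull ℝ).isClosed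
      obtain ⟨f, a, h1, h2⟩ := geometric_hahn_banach_point_closed (convex_convexHull ℝ _) hc hw
      set u := (InnerProductSpace.toDual ℝ _).symm f with hu
      have hf : ∀ y, inner ℝ u y = f y := fun y => by
        rw [hu]; exact InnerProductSpace.toDual_symm_apply
      have hlt : ∀ i, f w < f (x i) := fun i =>
        h1.trans (h2 _ (subset_convexHull ℝ _ ⟨i, rfl⟩))
      refine mem_supportedPairs_of_ne_zero (u := u) ?_ fun i => ?_
      · intro h0
        have := hlt ⟨0, hn⟩
        rw [← hf, ← hf, h0] at this
        simp at this
      · rw [inner_sub_right, hf, hf]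
        linarith [hlt i]
    have : z ∈ closure (samplePolytope x)ᶜ := by rwa [closure_compl]
    exact closure_minimal hsub hcl this
  · rintro ⟨u, hu, h⟩ hz
    have hsub : samplePolytope x ⊆ {y | inner ℝ u z ≤ inner ℝ u y} := by
      refine convexHull_min ?_ ?_
      · rintro _ ⟨i, rfl⟩
        have := h i
        simp only [inner_sub_right] at this
        simpa using this
      · exact convex_halfSpace_ge (innerSL ℝ u).isLinear _
    -- Moving from `z` slightly against `u` leaves the half-space, yet stays in the interior.
    have hT : Tendsto (fun s : ℝ => z - s • u) (𝓝 0) (𝓝 z) := by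
      have : Continuous fun s : ℝ => z - s • u := by fun_prop
      simpa using this.tendsto 0
    have hev : ∀ᶠ s : ℝ in 𝓝[>] 0, z - s • u ∈ interior (samplePolytope x) :=
      (hT.mono_left nhdsWithin_le_nhds).eventually (isOpen_interior.mem_nhds hz)
    obtain ⟨s, hs, hs0⟩ := (hev.and self_mem_nhdsWithin).exists
    have := hsub (interior_subset hs)
    simp only [Set.mem_ofPred_eq, inner_sub_right, real_inner_smul_right,
      real_inner_self_eq_norm_sq, hu] at this
    replace hs0 : 0 < s := hs0
    linarith

/-- The probability that `z` is not interior to the hull of `n` sample points (for `n ≥ 1`). -/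
noncomputable def escapeProb {d : ℕ} (μ : Measure (EuclideanSpace ℝ (Fin d))) (n : ℕ)
    (z : EuclideanSpace ℝ (Fin d)) : ℝ :=
  (sampleLaw μ n).real {x | (x, z) ∈ supportedPairs d n}

instance {d : ℕ} (μ : Measure (EuclideanSpace ℝ (Fin d))) [IsProbabilityMeasure μ] (n : ℕ) :
    IsProbabilityMeasure (sampleLaw μ n) := by
  unfold sampleLaw; infer_instance

/-! ### Expectations as integrals of the escape probability -/

section
variable {d : ℕ} (μ : Measure (EuclideanSpace ℝ (Fin d))) [IsProbabilityMeasure μ]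

theorem integral_measureReal_section_right {α β : Type*} [MeasurableSpace α] [MeasurableSpace β]
    (P : Measure α) (Q : Measure β) [IsProbabilityMeasure P] [IsProbabilityMeasure Q]
    {s : Set (α × β)} (hs : MeasurableSet s) :
    Integrable (fun x => Q.real {y | (x, y) ∈ s}) P ∧
      ∫ x, Q.real {y | (x, y) ∈ s} ∂P = (P.prod Q).real s := by
  have hm : Measurable fun x => Q.real {y | (x, y) ∈ s} :=
    (measurable_measure_prodMk_left hs).ennreal_toReal
  refine ⟨Integrable.of_bound hm.aestronglyMeasurable 1 (ae_of_all _ fun x => ?_), ?_⟩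
  · rw [Real.norm_of_nonneg measureReal_nonneg]; exact measureReal_le_one
  · have h1 := integral_prod (μ := P) (ν := Q) (s.indicator (fun _ => (1 : ℝ)))
      ((integrable_const 1).indicator hs)
    rw [integral_indicator hs] at h1
    simp only [integral_const, smul_eq_mul, mul_one, measureReal_restrict_apply_univ] at h1
    rw [h1]
    refine integral_congr_ae (ae_of_all _ fun x => ?_)
    have hx : MeasurableSet {y | (x, y) ∈ s} := measurable_prodMk_left hs
    have : (fun y => s.indicator (fun _ => (1 : ℝ)) (x, y)) =
        {y | (x, y) ∈ s}.indicator (fun _ => (1 : ℝ)) := rfl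
    beta_reduce; rw [this, integral_indicator hx]
    simp

theorem integral_measureReal_section_left {α β : Type*} [MeasurableSpace α] [MeasurableSpace β]
    (P : Measure α) (Q : Measure β) [IsProbabilityMeasure P] [IsProbabilityMeasure Q]
    {s : Set (α × β)} (hs : MeasurableSet s) :
    Integrable (fun y => P.real {x | (x, y) ∈ s}) Q ∧
      ∫ y, P.real {x | (x, y) ∈ s} ∂Q = (P.prod Q).real s := by
  have h := integral_measureReal_section_right Q P (measurable_swap hs)
  refine ⟨h.1, h.2.trans ?_⟩
  rw [measureReal_def, measureReal_def, ← Measure.prod_swap, Measure.map_apply measurable_swap]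
  · rfl
  · exact measurable_swap hs

theorem integrable_escapeProb (n : ℕ) : Integrable (escapeProb μ n) μ :=
  (integral_measureReal_section_left (sampleLaw μ n) μ (measurableSet_supportedPairs d n)).1

theorem missedMass_eq {n : ℕ} (hn : 0 < n) (x : Fin n → EuclideanSpace ℝ (Fin d)) :
    missedMass μ x = μ.real {z | (x, z) ∈ supportedPairs d n} := by
  unfold missedMass
  rw [← probReal_compl_eq_one_sub isOpen_interior.measurableSet]
  congr 1
  ext z
  exact notMem_interior_samplePolytope_iff hn x z

theorem integrable_missedMass {n : ℕ} (hn : 0 < n) :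
    Integrable (fun x : Fin n → EuclideanSpace ℝ (Fin d) => missedMass μ x) (sampleLaw μ n) := by
  simp only [missedMass_eq μ hn]
  exact (integral_measureReal_section_right _ _ (measurableSet_supportedPairs d n)).1

theorem expectedMissedMass_eq {n : ℕ} (hn : 0 < n) :
    expectedMissedMass μ n = ∫ z, escapeProb μ n z ∂μ := by
  unfold expectedMissedMass escapeProb
  simp only [missedMass_eq μ hn]
  rw [(integral_measureReal_section_left _ _ (measurableSet_supportedPairs d n)).2,
    (integral_measureReal_section_right _ _ (measurableSet_supportedPairs d n)).2]

/-- The condition at index `i` itself reads 0 ≤ 0, so `x i` acts as an independent point tested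
against the other `m`. -/
theorem sampleLaw_supportedPairs_self (m : ℕ) (i : Fin (m + 1)) :
    MeasurableSet {x : Fin (m + 1) → EuclideanSpace ℝ (Fin d) |
      (x, x i) ∈ supportedPairs d (m + 1)} ∧
    (sampleLaw μ (m + 1)).real {x | (x, x i) ∈ supportedPairs d (m + 1)} =
      ∫ z, escapeProb μ m z ∂μ := by
  have hms : MeasurableSet {q : EuclideanSpace ℝ (Fin d) × (Fin m → EuclideanSpace ℝ (Fin d)) |
      (q.2, q.1) ∈ supportedPairs d m} := measurable_swap (measurableSet_supportedPairs d m)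
  have hset : {x : Fin (m + 1) → EuclideanSpace ℝ (Fin d) |
      (x, x i) ∈ supportedPairs d (m + 1)} =
      MeasurableEquiv.piFinSuccAbove (fun _ => EuclideanSpace ℝ (Fin d)) i ⁻¹'
        {q | (q.2, q.1) ∈ supportedPairs d m} := by
    ext x
    simp only [supportedPairs, Set.mem_ofPred_eq, Set.mem_preimage]
    refine exists_congr fun u => and_congr_right fun _ => ?_
    rw [Fin.forall_iff_succAbove i]
    simp [Fin.removeNth]
  rw [hset]
  refine ⟨(MeasurableEquiv.piFinSuccAbove (fun _ => EuclideanSpace ℝ (Fin d)) i).measurable hms,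
    ?_⟩
  have hp := measurePreserving_piFinSuccAbove (fun _ : Fin (m + 1) => μ) i
  rw [measureReal_def, sampleLaw, hp.measure_preimage hms.nullMeasurableSet]
  exact (integral_measureReal_section_right μ (sampleLaw μ m) hms).2.symm

theorem boundaryCount_eq {m : ℕ} (x : Fin (m + 1) → EuclideanSpace ℝ (Fin d)) :
    (boundaryCount x : ℝ) =
      ∑ i, {x | (x, x i) ∈ supportedPairs d (m + 1)}.indicator (fun _ => (1 : ℝ)) x := by
  classical
  have hmem : ∀ i, x i ∈ frontier (samplePolytope x) ↔ (x, x i) ∈ supportedPairs d (m + 1) := by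
    intro i
    rw [← notMem_interior_samplePolytope_iff m.succ_pos, frontier, Set.mem_sdiff]
    exact and_iff_right (subset_closure (subset_convexHull ℝ _ ⟨i, rfl⟩))
  unfold boundaryCount
  simp only [hmem, Set.indicator_apply, Set.mem_ofPred_eq, Finset.sum_boole]
  rw [Set.ncard_eq_toFinset_card']
  congr 2
  ext i; simp

theorem integrable_boundaryCount (m : ℕ) :
    Integrable (fun x : Fin (m + 1) → EuclideanSpace ℝ (Fin d) => (boundaryCount x : ℝ))
      (sampleLaw μ (m + 1)) := by
  simp only [boundaryCount_eq]
  exact integrable_finsetSum _ fun i _ =>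
    (integrable_const 1).indicator (sampleLaw_supportedPairs_self μ m i).1

theorem expectedBoundaryCount_eq (m : ℕ) :
    expectedBoundaryCount μ (m + 1) = (m + 1) * ∫ z, escapeProb μ m z ∂μ := by
  unfold expectedBoundaryCount
  simp only [boundaryCount_eq]
  rw [integral_finsetSum _ fun i _ =>
    (integrable_const 1).indicator (sampleLaw_supportedPairs_self μ m i).1]
  have : ∀ i : Fin (m + 1), ∫ x, {x | (x, x i) ∈ supportedPairs d (m + 1)}.indicator
      (fun _ => (1 : ℝ)) x ∂(sampleLaw μ (m + 1)) = ∫ z, escapeProb μ m z ∂μ := by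
    intro i
    rw [integral_indicator (sampleLaw_supportedPairs_self μ m i).1,
      ← (sampleLaw_supportedPairs_self μ m i).2]
    simp
  simp [this]

end

/-! ### Escape probability on and off the closed wet part -/

section
variable {d : ℕ} (μ : Measure (EuclideanSpace ℝ (Fin d))) [IsProbabilityMeasure μ]

theorem measurableSet_supportedPairs_section (n : ℕ) (z : EuclideanSpace ℝ (Fin d)) :
    MeasurableSet {x | (x, z) ∈ supportedPairs d n} :=
  measurable_prodMk_right (measurableSet_supportedPairs d n)

/-- Upper semicontinuity: along w_k → z, a sample supported at infinitely many w_k is supported at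
z, and continuity from above bounds the limsup event below by `c`. -/
theorem le_escapeProb_of_mem_closure {n : ℕ} {c : ℝ} {S : Set (EuclideanSpace ℝ (Fin d))}
    (hS : ∀ z ∈ S, c ≤ escapeProb μ n z) {z : EuclideanSpace ℝ (Fin d)} (hz : z ∈ closure S) :
    c ≤ escapeProb μ n z := by
  obtain ⟨w, hwS, hw⟩ := mem_closure_iff_seq_limit.1 hz
  set A : ℕ → Set (Fin n → EuclideanSpace ℝ (Fin d)) :=
    fun k => {x | (x, w k) ∈ supportedPairs d n} with hA
  set B : ℕ → Set (Fin n → EuclideanSpace ℝ (Fin d)) := fun j => ⋃ k ≥ j, A k with hB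
  have hBm : ∀ j, MeasurableSet (B j) := fun j =>
    MeasurableSet.biUnion (Set.to_countable _) fun k _ =>
      measurableSet_supportedPairs_section n (w k)
  have hanti : Antitone B := fun i j hij =>
    Set.biUnion_mono (fun k (hk : j ≤ k) => hij.trans hk) fun _ _ => subset_rfl
  have hlim := tendsto_measure_iInter_atTop (μ := sampleLaw μ n)
    (fun j => (hBm j).nullMeasurableSet) hanti ⟨0, measure_ne_top _ _⟩
  have hsub : (⋂ j, B j) ⊆ {x | (x, z) ∈ supportedPairs d n} := by
    intro x hx
    have hfreq : ∃ᶠ k in atTop, (x, w k) ∈ supportedPairs d n := by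
      rw [frequently_atTop]
      intro j
      have := Set.mem_iInter.1 hx j
      simpa [hB, hA] using this
    exact (isClosed_supportedPairs d n).mem_of_frequently_of_tendsto hfreq
      (tendsto_const_nhds.prodMk_nhds hw)
  have hlim' : Tendsto (fun j => (sampleLaw μ n).real (B j)) atTop
      (𝓝 ((sampleLaw μ n).real (⋂ j, B j))) :=
    (ENNReal.tendsto_toReal (measure_ne_top _ _)).comp hlim
  refine (ge_of_tendsto' hlim' fun j => ?_).trans (measureReal_mono hsub)
  exact (hS _ (hwS j)).trans (measureReal_mono
    (Set.subset_biUnion_of_mem (u := A) (show j ∈ {k | k ≥ j} from le_refl j))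
    (measure_ne_top _ _))

theorem sampleLaw_real_forall_mem (n : ℕ) (s : Set (EuclideanSpace ℝ (Fin d))) :
    (sampleLaw μ n).real {x | ∀ i, x i ∈ s} = μ.real s ^ n := by
  have : {x : Fin n → EuclideanSpace ℝ (Fin d) | ∀ i, x i ∈ s} = Set.univ.pi fun _ => s := by
    ext x; simp
  rw [this, measureReal_def, sampleLaw, Measure.pi_pi]
  simp [measureReal_def]

theorem IsClosedHalfspace.measurableSet {h : Set (EuclideanSpace ℝ (Fin d))}
    (hh : IsClosedHalfspace h) : MeasurableSet h := by
  obtain ⟨u, c, -, rfl⟩ := hh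
  exact measurableSet_le (by fun_prop) measurable_const

theorem one_sub_pow_le_escapeProb {t : ℝ} (ht : t ≤ 1) (n : ℕ)
    {z : EuclideanSpace ℝ (Fin d)} (hz : z ∈ closure (wetPart μ t)) :
    (1 - t) ^ n ≤ escapeProb μ n z := by
  refine le_escapeProb_of_mem_closure μ ?_ hz
  rintro w ⟨h, hh, hwh, hμ⟩
  calc (1 - t) ^ n ≤ μ.real hᶜ ^ n := by
        refine pow_le_pow_left₀ (by linarith) ?_ n
        rw [probReal_compl_eq_one_sub hh.measurableSet]
        linarith
    _ = (sampleLaw μ n).real {x | ∀ i, x i ∈ hᶜ} := (sampleLaw_real_forall_mem μ n _).symm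
    _ ≤ escapeProb μ n w := by
        refine measureReal_mono ?_
        obtain ⟨u, c, hu, rfl⟩ := hh
        intro x hx
        refine mem_supportedPairs_of_ne_zero hu fun i => ?_
        have h1 : ¬ inner ℝ u (x i) ≤ c := hx i
        have h2 : inner ℝ u w ≤ c := hwh
        rw [inner_sub_right]
        linarith

theorem one_sub_pow_mul_closedWetMeasure_le {t : ℝ} (ht : t ≤ 1) (n : ℕ) :
    (1 - t) ^ n * closedWetMeasure μ t ≤ ∫ z, escapeProb μ n z ∂μ := by
  have hm : MeasurableSet (closure (wetPart μ t)) := isClosed_closure.measurableSet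
  have : (1 - t) ^ n * closedWetMeasure μ t =
      ∫ z, (closure (wetPart μ t)).indicator (fun _ => (1 - t) ^ n) z ∂μ := by
    rw [integral_indicator hm]
    simp [closedWetMeasure, mul_comm]
  rw [this]
  refine integral_mono ((integrable_const _).indicator hm) (integrable_escapeProb μ n) fun z => ?_
  by_cases hz : z ∈ closure (wetPart μ t)
  · simpa [hz] using one_sub_pow_le_escapeProb μ ht n hz
  · rw [Set.indicator_of_notMem hz]; exact measureReal_nonneg

/-- A point slightly displaced from `z` along `-u` is still not wet, and the closed half-space
through it lies in the open one at `z`. Openness matters: the complement is then the closed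
half-space of the supporting condition. -/
theorem lt_measureReal_of_notMem_closure_wetPart {t : ℝ} {z u : EuclideanSpace ℝ (Fin d)}
    (hz : z ∉ closure (wetPart μ t)) (hu : u ≠ 0) :
    t < μ.real {y | inner ℝ u (y - z) < 0} := by
  have hT : Tendsto (fun s : ℝ => z - s • u) (𝓝 0) (𝓝 z) := by
    have : Continuous fun s : ℝ => z - s • u := by fun_prop
    simpa using this.tendsto 0
  have hev : ∀ᶠ s : ℝ in 𝓝[>] 0, z - s • u ∈ (closure (wetPart μ t))ᶜ :=
    (hT.mono_left nhdsWithin_le_nhds).eventually (isClosed_closure.isOpen_compl.mem_nhds hz)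
  obtain ⟨s, hs, hs0⟩ := (hev.and self_mem_nhdsWithin).exists
  replace hs0 : 0 < s := hs0
  by_contra! hle
  refine hs (subset_closure ⟨{y | inner ℝ u y ≤ inner ℝ u (z - s • u)}, ⟨u, _, hu, rfl⟩, ?_, ?_⟩)
  · exact le_refl (inner ℝ u (z - s • u))
  · refine (measureReal_mono ?_).trans hle
    intro y (hy : inner ℝ u y ≤ inner ℝ u (z - s • u))
    have hpos : 0 < ‖u‖ ^ 2 := by have := norm_pos_iff.2 hu; positivity
    rw [inner_sub_right, real_inner_smul_right, real_inner_self_eq_norm_sq] at hy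
    change inner ℝ u (y - z) < 0
    rw [inner_sub_right]
    nlinarith

end

/-! ### Supporting directions determined by few sample points -/

open scoped Matrix in
/-- If a polyhedral cone has a nonzero point, then it has a nonzero point that solves a linear
system whose rows are among the constraints and the coordinate vectors, with right-hand side
entries in `{-1, 0, 1}`. -/
theorem exists_isUnit_matrix_mulVec_eq {d m : ℕ} (v : Fin m → Fin d → ℝ) {u : Fin d → ℝ}
    (hu : u ≠ 0) (hv : ∀ i, 0 ≤ v i ⬝ᵥ u) :
    ∃ (w : Fin d → ℝ) (g : Fin d → Fin m ⊕ Fin d) (b : Fin d → SignType), w ≠ 0 ∧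
      (∀ i, 0 ≤ v i ⬝ᵥ w) ∧
      IsUnit (Matrix.of fun k => Sum.elim v (fun l => Pi.single l 1) (g k)) ∧
      (Matrix.of fun k => Sum.elim v (fun l => Pi.single l 1) (g k)) *ᵥ w =
        fun k => (b k : ℝ) := by
  -- The cube makes the cone compact, so Krein–Milman supplies a nonzero extreme point.
  set K : Set (Fin d → ℝ) := {w | (∀ i, 0 ≤ v i ⬝ᵥ w) ∧ w ∈ Set.Icc (-1) 1} with hK
  have hKc : IsCompact K := by
    refine isCompact_Icc.of_isClosed_subset (s := Set.Icc (-1) 1) ?_ fun w hw => hw.2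
    refine IsClosed.and ?_ isClosed_Icc
    simp only [Set.ofPred_forall]
    exact isClosed_iInter fun i => isClosed_le continuous_const (by fun_prop)
  have hKconv : Convex ℝ K := by
    refine Convex.inter ?_ (convex_Icc _ _)
    intro x hx y hy a c ha hc _ i
    rw [dotProduct_add, dotProduct_smul, dotProduct_smul]
    exact add_nonneg (mul_nonneg ha (hx i)) (mul_nonneg hc (hy i))
  have hn : 0 < ‖u‖ := norm_pos_iff.2 hu
  have hu1 : (‖u‖⁻¹ • u) ∈ K := by
    refine ⟨fun i => ?_, ?_⟩
    · rw [dotProduct_smul]; exact mul_nonneg (by positivity) (hv i)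
    · have h1 : ‖(‖u‖⁻¹ • u)‖ ≤ 1 := by
        rw [norm_smul, norm_inv, norm_norm, inv_mul_cancel₀ hn.ne']
      rw [Set.mem_Icc, Pi.le_def, Pi.le_def, ← forall_and]
      intro j
      exact abs_le.1 ((norm_le_pi_norm (‖u‖⁻¹ • u) j).trans h1)
  obtain ⟨w, hw, hw0⟩ : ∃ w ∈ Set.extremePoints ℝ K, w ≠ 0 := by
    by_contra! hcon
    have h1 := closure_convexHull_extremePoints hKc hKconv
    have h2 : closure (convexHull ℝ (Set.extremePoints ℝ K)) ⊆ {0} :=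
      closure_minimal (convexHull_min hcon (convex_singleton 0)) isClosed_singleton
    rw [h1] at h2
    exact smul_ne_zero (inv_ne_zero hn.ne') hu (h2 hu1)
  set row : Fin m ⊕ Fin d → Fin d → ℝ := Sum.elim v (fun l => Pi.single l 1) with hrow
  -- The tight constraints; a coordinate row counts only at ±1, since its vanishing is not a
  -- constraint.
  set T : Set (Fin m ⊕ Fin d) := {k | row k ⬝ᵥ w = 0 ∧ k.isLeft ∨ |row k ⬝ᵥ w| = 1} with hT
  -- Otherwise some `p ≠ 0` is orthogonal to all tight rows, and `w ± s • p` stays in `K` for small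
  -- `s`, against extremality.
  have hspan : Submodule.span ℝ (Set.range fun k : T => row k) = ⊤ := by
    by_contra hne
    obtain ⟨f, hf0, hf⟩ := Submodule.exists_le_ker_of_lt_top _ (lt_top_iff_ne_top.2 hne)
    set p : Fin d → ℝ := fun j => f (Pi.single j 1) with hp
    have hfp : ∀ y, f y = y ⬝ᵥ p := by
      intro y
      rw [LinearMap.pi_apply_eq_sum_univ f y]
      refine Finset.sum_congr rfl fun j _ => ?_
      rw [smul_eq_mul, hp]
      congr 2
      ext l
      simp [Pi.single_apply, eq_comm]
    have hp0 : p ≠ 0 := by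
      intro h0
      apply hf0
      ext y
      simp [hfp, h0]
    have hTp : ∀ k ∈ T, row k ⬝ᵥ p = 0 := fun k hk => by
      rw [← hfp]
      exact LinearMap.mem_ker.1 (hf (Submodule.subset_span ⟨⟨k, hk⟩, rfl⟩))
    have hcont : ∀ y : Fin d → ℝ, Tendsto (fun s : ℝ => y ⬝ᵥ (w + s • p)) (𝓝 0) (𝓝 (y ⬝ᵥ w)) := by
      intro y
      have : Continuous fun s : ℝ => y ⬝ᵥ (w + s • p) := by fun_prop
      simpa using this.tendsto 0
    have hev : ∀ᶠ s : ℝ in 𝓝 0, w + s • p ∈ K := by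
      refine Filter.Eventually.and ?_ ?_
      · rw [eventually_all]
        intro i
        rcases (hw.1.1 i).eq_or_lt with h | h
        · have := hTp (Sum.inl i) (Or.inl ⟨h.symm, rfl⟩)
          filter_upwards with s
          have h3 : v i ⬝ᵥ p = 0 := this
          rw [dotProduct_add, dotProduct_smul, h3, ← h]
          simp
        · filter_upwards [(hcont (v i)).eventually (lt_mem_nhds h)] with s hs using hs.le
      · have : ∀ j, ∀ᶠ s : ℝ in 𝓝 0, |(w + s • p) j| ≤ 1 := by
          intro j
          have hj1 : ∀ y : Fin d → ℝ, row (Sum.inr j) ⬝ᵥ y = y j := fun y => by simp [hrow]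
          have hj : |w j| ≤ 1 := abs_le.2 ⟨hw.1.2.1 j, hw.1.2.2 j⟩
          rcases hj.eq_or_lt with h | h
          · have h3 := hTp (Sum.inr j) (Or.inr (by rw [hj1]; exact h))
            rw [hj1] at h3
            filter_upwards with s
            simp [h3, h]
          · have h4 := (hcont (row (Sum.inr j))).abs
            simp only [hj1] at h4
            filter_upwards [h4.eventually (gt_mem_nhds h)] with s hs using hs.le
        filter_upwards [eventually_all.2 this] with s hs
        exact ⟨fun j => (abs_le.1 (hs j)).1, fun j => (abs_le.1 (hs j)).2⟩
    obtain ⟨δ, hδ, hball⟩ := Metric.eventually_nhds_iff.1 hev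
    have h1 : w + (δ / 2) • p ∈ K := hball (by
      rw [Real.dist_eq, sub_zero, abs_of_pos (by positivity)]; linarith)
    have h2 : w + (-(δ / 2)) • p ∈ K := hball (by
      rw [Real.dist_eq, sub_zero, abs_neg, abs_of_pos (by positivity)]; linarith)
    have h3 : w + (δ / 2) • p = w := by
      refine (mem_extremePoints_iff_left.1 hw).2 _ h1 _ h2
        ⟨1 / 2, 1 / 2, by norm_num, by norm_num, by norm_num, ?_⟩
      ext j
      simp
      ring
    have h4 : (δ / 2) • p = 0 := by simpa using h3
    exact smul_ne_zero (by positivity) hp0 h4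
  obtain ⟨κ, a, -, hsp, hli⟩ := exists_linearIndependent' ℝ fun k : T => row k
  rw [hspan] at hsp
  let B : Module.Basis κ ℝ (Fin d → ℝ) := Module.Basis.mk hli hsp.ge
  have : Finite κ := Module.Finite.finite_basis B
  have : Fintype κ := Fintype.ofFinite κ
  have hcard : Fintype.card κ = Fintype.card (Fin d) := by
    rw [← Module.finrank_eq_card_basis B]; simp
  let e : Fin d ≃ κ := (Fintype.equivOfCardEq hcard).symm
  refine ⟨w, fun k => (a (e k)).1, fun k => SignType.sign (row (a (e k)).1 ⬝ᵥ w), hw0, hw.1.1,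
    ?_, ?_⟩
  · rw [← Matrix.linearIndependent_rows_iff_isUnit]
    exact hli.comp e e.injective
  · ext k
    change row (a (e k)).1 ⬝ᵥ w = ((SignType.sign (row (a (e k)).1 ⬝ᵥ w) : SignType) : ℝ)
    rcases (a (e k)).2 with h | h
    · rw [h.1]; simp
    · rcases (abs_eq zero_le_one).1 h with h' | h' <;> rw [h'] <;> simp

/-- If membership in `A` forces, once the coordinates satisfying `p` are fixed, all the other
coordinates into a set of measure at most `c`, then the measure of `A` is at most a power of `c`. -/
theorem pi_measure_le_pow {ι α : Type*} [Fintype ι] [MeasurableSpace α] (μ : Measure α)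
    [IsProbabilityMeasure μ] (p : ι → Prop) [DecidablePred p] {A : Set (ι → α)}
    (hA : MeasurableSet A) (c : ENNReal)
    (h : ∀ a : {i // p i} → α, ∃ C : Set α, μ C ≤ c ∧
      ∀ x ∈ A, (∀ i : {i // p i}, x i = a i) → ∀ i, ¬ p i → x i ∈ C) :
    Measure.pi (fun _ : ι => μ) A ≤ c ^ Fintype.card {i // ¬ p i} := by
  let e := MeasurableEquiv.piEquivPiSubtypeProd (fun _ : ι => α) p
  have he := measurePreserving_piEquivPiSubtypeProd (fun _ : ι => μ) p
  have hA' : A = e ⁻¹' (e.symm ⁻¹' A) := by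
    ext x; simp
  have hm : MeasurableSet (e.symm ⁻¹' A) := e.symm.measurable hA
  rw [hA', he.measure_preimage hm.nullMeasurableSet, Measure.prod_apply hm]
  calc _ ≤ ∫⁻ _, c ^ Fintype.card {i // ¬ p i} ∂(Measure.pi fun _ : {i // p i} => μ) := by
        refine lintegral_mono fun a => ?_
        obtain ⟨C, hC, hx⟩ := h a
        calc _ ≤ Measure.pi (fun _ : {i // ¬ p i} => μ) (Set.univ.pi fun _ => C) := by
              refine measure_mono fun y hy i _ => ?_
              have hy' : e.symm (a, y) ∈ A := hy
              have h1 : ∀ i : {i // p i}, e.symm (a, y) i = a i := fun i => by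
                have := congrFun (congrArg Prod.fst (e.apply_symm_apply (a, y))) i
                exact this
              have h2 : e.symm (a, y) i = y i := by
                have := congrFun (congrArg Prod.snd (e.apply_symm_apply (a, y))) i
                exact this
              rw [← h2]
              exact hx _ hy' h1 i i.2
          _ ≤ _ := by
              rw [Measure.pi_pi]
              simp only [Finset.prod_const, Finset.card_univ]
              gcongr
    _ = _ := by simp

open scoped Matrix in
/-- The solution of the linear system with rows `v i`, or a coordinate vector, as selected by `g`,
and right-hand side `b`. It is `0` if the system is singular. -/
noncomputable def coneVertex {d m : ℕ} (g : Fin d → Fin m ⊕ Fin d) (b : Fin d → SignType)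
    (v : Fin m → EuclideanSpace ℝ (Fin d)) : EuclideanSpace ℝ (Fin d) :=
  WithLp.toLp 2 ((Matrix.of fun k =>
    Sum.elim (fun i => (v i).ofLp) (fun l => Pi.single l 1) (g k))⁻¹ *ᵥ fun k => (b k : ℝ))

theorem measurable_coneVertex {d m : ℕ} (g : Fin d → Fin m ⊕ Fin d) (b : Fin d → SignType) :
    Measurable (coneVertex g b) := by
  have hc : Continuous fun v : Fin m → EuclideanSpace ℝ (Fin d) => (Matrix.of fun k =>
      Sum.elim (fun i => (v i).ofLp) (fun l => Pi.single l 1) (g k) :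
        Matrix (Fin d) (Fin d) ℝ) := by
    refine continuous_matrix fun k j => ?_
    rcases hk : g k with i | l
    · simp only [Matrix.of_apply, hk, Sum.elim_inl]; fun_prop
    · simp only [Matrix.of_apply, hk, Sum.elim_inr]; fun_prop
  unfold coneVertex
  -- The inverse is det⁻¹ times the adjugate; with 0⁻¹ = 0 this is measurable on singular matrices
  -- too.
  simp only [Matrix.inv_def, Matrix.smul_mulVec, Ring.inverse_eq_inv', WithLp.toLp_smul]
  refine Measurable.smul (hc.matrix_det.measurable.inv) ?_
  refine Continuous.measurable ?_
  have := hc.matrix_adjugate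
  refine (PiLp.continuous_toLp 2 _).comp ?_
  exact this.matrix_mulVec continuous_const

/-- This dependence on the selected points alone permits conditioning on them. -/
theorem coneVertex_congr {d m : ℕ} {g : Fin d → Fin m ⊕ Fin d} (b : Fin d → SignType)
    {v v' : Fin m → EuclideanSpace ℝ (Fin d)} (h : ∀ i k, g k = Sum.inl i → v i = v' i) :
    coneVertex g b v = coneVertex g b v' := by
  unfold coneVertex
  congr 4
  ext k j
  rcases hk : g k with i | l
  · simp [h i k hk]
  · simp

theorem exists_coneVertex {d m : ℕ} (v : Fin m → EuclideanSpace ℝ (Fin d))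
    {u : EuclideanSpace ℝ (Fin d)} (hu : u ≠ 0) (hv : ∀ i, 0 ≤ inner ℝ u (v i)) :
    ∃ g b, coneVertex g b v ≠ 0 ∧ ∀ i, 0 ≤ inner ℝ (coneVertex g b v) (v i) := by
  obtain ⟨w, g, b, hw, h1, h2, h3⟩ := exists_isUnit_matrix_mulVec_eq (fun i => (v i).ofLp)
    (u := u.ofLp) (by simpa using hu) (fun i => by
      have := hv i
      rwa [EuclideanSpace.inner_eq_star_dotProduct] at this)
  have : coneVertex g b v = WithLp.toLp 2 w := by
    unfold coneVertex
    rw [← h3, Matrix.mulVec_mulVec,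
      Matrix.nonsing_inv_mul _ ((Matrix.isUnit_iff_isUnit_det _).1 h2), Matrix.one_mulVec]
  refine ⟨g, b, ?_, fun i => ?_⟩
  · rw [this]; simpa using hw
  · rw [this, EuclideanSpace.inner_eq_star_dotProduct]
    exact h1 i

/-! ### Union bound for the escape probability -/

section
variable {d : ℕ} (μ : Measure (EuclideanSpace ℝ (Fin d))) [IsProbabilityMeasure μ]

/-- The samples `x` for which the cone vertex selected by `g` and `b` supports the sample at `z`. -/
def coneVertexEvent {d m : ℕ} (g : Fin d → Fin m ⊕ Fin d) (b : Fin d → SignType)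
    (z : EuclideanSpace ℝ (Fin d)) : Set (Fin m → EuclideanSpace ℝ (Fin d)) :=
  {x | coneVertex g b (fun i => x i - z) ≠ 0 ∧
    ∀ i, 0 ≤ inner ℝ (coneVertex g b fun i => x i - z) (x i - z)}

theorem measurableSet_coneVertexEvent {d m : ℕ} (g : Fin d → Fin m ⊕ Fin d)
    (b : Fin d → SignType) (z : EuclideanSpace ℝ (Fin d)) :
    MeasurableSet (coneVertexEvent g b z) := by
  have hsub : Measurable fun (x : Fin m → EuclideanSpace ℝ (Fin d)) i => x i - z :=
    measurable_pi_lambda _ fun i => ((continuous_apply i).sub continuous_const).measurable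
  have hvm := (measurable_coneVertex g b).comp hsub
  have hi : ∀ i, MeasurableSet {x : Fin m → EuclideanSpace ℝ (Fin d) |
      0 ≤ inner ℝ ((coneVertex g b ∘ fun x i => x i - z) x) (x i - z)} := fun i =>
    measurableSet_le measurable_const
      (hvm.inner ((continuous_apply i).sub continuous_const).measurable)
  have := (hvm (measurableSet_singleton 0).compl).inter (MeasurableSet.iInter hi)
  convert this using 1
  ext x
  simp [coneVertexEvent]

theorem card_sub_le_card_subtype_not {d m : ℕ} (g : Fin d → Fin m ⊕ Fin d)
    [DecidablePred fun i => ∃ k, g k = Sum.inl i] :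
    m - d ≤ Fintype.card {i // ¬ ∃ k, g k = Sum.inl i} := by
  have h1 : Fintype.card {i // ∃ k, g k = Sum.inl i} ≤ d := by
    have hinj : Function.Injective fun i : {i // ∃ k, g k = Sum.inl i} => i.2.choose := by
      intro i j hij
      have hi := i.2.choose_spec
      have hj := j.2.choose_spec
      simp only at hij
      rw [hij, hj] at hi
      exact Subtype.ext (Sum.inl_injective hi).symm
    simpa using Fintype.card_le_of_injective _ hinj
  rw [Fintype.card_subtype_compl, Fintype.card_fin]
  omega

theorem sampleLaw_coneVertexEvent_le {c : ℝ} (hc0 : 0 ≤ c) (hc1 : c ≤ 1) {m : ℕ}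
    {z : EuclideanSpace ℝ (Fin d)}
    (hz : ∀ u : EuclideanSpace ℝ (Fin d), u ≠ 0 → μ.real {y | 0 ≤ inner ℝ u (y - z)} ≤ c)
    (g : Fin d → Fin m ⊕ Fin d) (b : Fin d → SignType) :
    (sampleLaw μ m).real (coneVertexEvent g b z) ≤ c ^ (m - d) := by
  classical
  have key := pi_measure_le_pow μ (fun i => ∃ k, g k = Sum.inl i)
    (measurableSet_coneVertexEvent g b z) (ENNReal.ofReal c) (fun a => by
    -- The filler value 0 is immaterial: the vertex ignores unselected points.
    let x' : Fin m → EuclideanSpace ℝ (Fin d) :=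
      fun i => if h : ∃ k, g k = Sum.inl i then a ⟨i, h⟩ else 0
    obtain ⟨w, hw⟩ : ∃ w, w = coneVertex g b fun i => x' i - z := ⟨_, rfl⟩
    have hxw : ∀ x : Fin m → EuclideanSpace ℝ (Fin d),
        (∀ i : {i // ∃ k, g k = Sum.inl i}, x i = a i) →
        (coneVertex g b fun i => x i - z) = w := by
      intro x hx
      rw [hw]
      refine coneVertex_congr b fun i k hk => ?_
      have hi : ∃ k, g k = Sum.inl i := ⟨k, hk⟩
      simp only [x', dif_pos hi]
      rw [hx ⟨i, hi⟩]
    by_cases hw0 : w = 0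
    · refine ⟨∅, by simp, fun x hx hxa => ?_⟩
      exact absurd ((hxw x hxa).trans hw0) hx.1
    · refine ⟨{y | 0 ≤ inner ℝ w (y - z)}, ?_, fun x hx hxa i _ => ?_⟩
      · rw [← ofReal_measureReal]
        exact ENNReal.ofReal_le_ofReal (hz w hw0)
      · have := hx.2 i
        rwa [hxw x hxa] at this)
  have h2 : (sampleLaw μ m).real (coneVertexEvent g b z) ≤
      c ^ Fintype.card {i // ¬ ∃ k, g k = Sum.inl i} := by
    rw [← ENNReal.ofReal_pow hc0] at key
    exact ENNReal.toReal_le_of_le_ofReal (by positivity) key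
  exact h2.trans (pow_le_pow_of_le_one hc0 hc1 (card_sub_le_card_subtype_not g))

theorem escapeProb_le {c : ℝ} (hc0 : 0 ≤ c) (hc1 : c ≤ 1) (m : ℕ)
    {z : EuclideanSpace ℝ (Fin d)}
    (hz : ∀ u : EuclideanSpace ℝ (Fin d), u ≠ 0 → μ.real {y | 0 ≤ inner ℝ u (y - z)} ≤ c) :
    escapeProb μ m z ≤ (3 * (m + d)) ^ d * c ^ (m - d) := by
  let A : (Fin d → Fin m ⊕ Fin d) × (Fin d → SignType) →
    Set (Fin m → EuclideanSpace ℝ (Fin d)) := fun q => coneVertexEvent q.1 q.2 z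
  calc escapeProb μ m z ≤ (sampleLaw μ m).real (⋃ q, A q) := by
        refine measureReal_mono ?_
        rintro x ⟨u, hu, h⟩
        have hu0 : u ≠ 0 := by rintro rfl; simp at hu
        obtain ⟨g, b, h1⟩ := exists_coneVertex (fun i => x i - z) hu0 h
        exact Set.mem_iUnion.2 ⟨(g, b), h1⟩
    _ ≤ ∑ q, (sampleLaw μ m).real (A q) := measureReal_iUnion_fintype_le A
    _ ≤ ∑ _q : (Fin d → Fin m ⊕ Fin d) × (Fin d → SignType), c ^ (m - d) :=
        Finset.sum_le_sum fun q _ => sampleLaw_coneVertexEvent_le μ hc0 hc1 hz q.1 q.2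
    _ = (3 * (m + d)) ^ d * c ^ (m - d) := by
        have h3 : Fintype.card SignType = 3 := rfl
        simp only [Finset.sum_const, Finset.card_univ, Fintype.card_prod, Fintype.card_fun,
          Fintype.card_sum, Fintype.card_fin, h3, nsmul_eq_mul]
        push_cast
        rw [mul_pow]
        ring

theorem integral_escapeProb_le (t : ℝ) (ht : 0 ≤ t) (m : ℕ) :
    ∫ z, escapeProb μ m z ∂μ ≤
      closedWetMeasure μ t + (3 * (m + d)) ^ d * Real.exp (-t) ^ (m - d) := by
  have hm : MeasurableSet (closure (wetPart μ t)) := isClosed_closure.measurableSet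
  set δ : ℝ := (3 * (m + d)) ^ d * Real.exp (-t) ^ (m - d) with hδ
  have hδ0 : 0 ≤ δ := by positivity
  have : closedWetMeasure μ t + δ =
      ∫ z, ((closure (wetPart μ t)).indicator (fun _ => (1 : ℝ)) z + δ) ∂μ := by
    rw [integral_add ((integrable_const _).indicator hm) (integrable_const _),
      integral_indicator hm]
    simp [closedWetMeasure]
  rw [this]
  refine integral_mono (integrable_escapeProb μ m)
    (((integrable_const _).indicator hm).add (integrable_const _)) fun z => ?_
  by_cases hz : z ∈ closure (wetPart μ t)
  · have h1 : escapeProb μ m z ≤ 1 := measureReal_le_one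
    simp only [hz, Set.indicator_of_mem]
    linarith
  · simp only [hz, not_false_eq_true, Set.indicator_of_notMem, zero_add]
    -- Taking c = e^{-t} ≥ 1 - t keeps c nonnegative even when t > 1.
    refine escapeProb_le μ (Real.exp_pos _).le (Real.exp_le_one_iff.2 (by linarith)) m
      fun u hu => ?_
    have h1 := lt_measureReal_of_notMem_closure_wetPart μ hz hu
    have h2 : {y | 0 ≤ inner ℝ u (y - z)} = {y | inner ℝ u (y - z) < 0}ᶜ := by
      ext y; simp
    rw [h2, probReal_compl_eq_one_sub (measurableSet_lt (by fun_prop) measurable_const)]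
    linarith [Real.add_one_le_exp (-t)]

end

/-! ### Numerical estimates -/

/-- The error term of the upper bound for the expected number of boundary points. -/
noncomputable def hullError (d n : ℕ) : ℝ :=
  n * ((3 * (n + d)) ^ d * Real.exp (-(((d : ℝ) + 2) * (Real.log n / n))) ^ (n - 1 - d))

theorem hullError_le {d n : ℕ} (hn : d + 1 ≤ n) :
    hullError d n ≤ (3 * (d + 1)) ^ d * Real.exp ((d + 2) * (d + 1)) / n := by
  have hn0 : (0 : ℝ) < n := by exact_mod_cast (by omega : 0 < n)
  have hn1 : (1 : ℝ) ≤ n := by exact_mod_cast (by omega : 1 ≤ n)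
  have hcast : ((n - 1 - d : ℕ) : ℝ) = n - (d + 1) := by
    rw [Nat.sub_sub, Nat.cast_sub (by omega)]; push_cast; ring
  -- The exponent falls short of n by d + 1; as ln n / n ≤ 1, this costs only a constant factor.
  have h1 : Real.exp (-(((d : ℝ) + 2) * (Real.log n / n))) ^ (n - 1 - d) ≤
      Real.exp ((d + 2) * (d + 1)) / (n : ℝ) ^ (d + 2) := by
    have hpow : (n : ℝ) ^ (d + 2) = Real.exp ((d + 2) * Real.log n) := by
      have := Real.exp_nat_mul (Real.log n) (d + 2)
      rw [Real.exp_log hn0] at this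
      rw [← this]; push_cast; rfl
    rw [hpow, ← Real.exp_sub, ← Real.exp_nat_mul, Real.exp_le_exp, hcast]
    have h2 : Real.log n / n ≤ 1 := by
      rw [div_le_one hn0]; linarith [Real.log_le_sub_one_of_pos hn0]
    have h3 : Real.log n = n * (Real.log n / n) := by field_simp
    have h4 : ((n : ℝ) - (d + 1)) * (-((d + 2) * (Real.log n / n))) =
        (d + 2) * (d + 1) * (Real.log n / n) - (d + 2) * (n * (Real.log n / n)) := by ring
    rw [h4, ← h3]
    have : ((d : ℝ) + 2) * (d + 1) * (Real.log n / n) ≤ (d + 2) * (d + 1) * 1 := by gcongr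
    linarith
  have h5 : (3 * ((n : ℝ) + d)) ^ d ≤ (3 * (d + 1)) ^ d * n ^ d := by
    rw [← mul_pow]
    refine pow_le_pow_left₀ (by positivity) ?_ d
    nlinarith [mul_nonneg (Nat.cast_nonneg (α := ℝ) d) (sub_nonneg.2 hn1)]
  calc hullError d n ≤ n * (((3 * (d + 1)) ^ d * n ^ d) *
        (Real.exp ((d + 2) * (d + 1)) / (n : ℝ) ^ (d + 2))) := by
        unfold hullError; gcongr
    _ = _ := by field_simp; ring

theorem tendsto_hullError (d : ℕ) : Tendsto (hullError d) atTop (𝓝 0) := by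
  have h := (tendsto_const_div_atTop_nhds_zero_nat
    ((3 * ((d : ℝ) + 1)) ^ d * Real.exp ((d + 2) * (d + 1))))
  refine squeeze_zero' (Eventually.of_forall fun n => ?_) ?_ h
  · unfold hullError; positivity
  · filter_upwards [eventually_ge_atTop (d + 1)] with n hn using hullError_le hn

/-- Bernoulli's inequality with real exponent n/2 ≥ 1 gives (1 - 1/n)^{n/2} ≥ 1/2; then square. -/
theorem one_div_four_le_one_sub_one_div_pow {n : ℕ} (hn : 2 ≤ n) :
    (1 / 4 : ℝ) ≤ (1 - 1 / n) ^ n := by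
  have hn2 : (2 : ℝ) ≤ n := by exact_mod_cast hn
  have hn0 : (0 : ℝ) < n := by linarith
  have h0 : (0 : ℝ) ≤ 1 + -(1 / n) := by
    have : (1 : ℝ) / n ≤ 1 := by rw [div_le_one hn0]; linarith
    linarith
  have h1 := one_add_mul_self_le_rpow_one_add (s := -(1 / (n : ℝ))) (by linarith)
    (p := (n : ℝ) / 2) (by linarith)
  have h2 : (1 : ℝ) + n / 2 * -(1 / n) = 1 / 2 := by field_simp; norm_num
  rw [h2] at h1
  have h3 : ((1 + -(1 / (n : ℝ))) ^ ((n : ℝ) / 2)) ^ 2 = (1 - 1 / n) ^ n := by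
    rw [← Real.rpow_natCast _ 2, ← Real.rpow_mul h0]
    push_cast
    rw [div_mul_cancel₀ _ two_ne_zero, Real.rpow_natCast, sub_eq_add_neg]
  rw [← h3]
  nlinarith

theorem one_div_exp_one_le_one_sub_one_div_pow {m : ℕ} (hm : 1 ≤ m) :
    1 / Real.exp 1 ≤ (1 - 1 / ((m + 1 : ℕ) : ℝ)) ^ m := by
  have hm0 : (0 : ℝ) < m := by exact_mod_cast hm
  have h1 : (1 : ℝ) - 1 / ((m + 1 : ℕ) : ℝ) = 1 / (1 + 1 / m) := by
    push_cast; field_simp; ring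
  rw [h1, one_div_pow]
  have h2 : (1 + 1 / (m : ℝ)) ^ m ≤ Real.exp 1 := by
    calc (1 + 1 / (m : ℝ)) ^ m ≤ Real.exp (1 / m) ^ m := by
          gcongr
          linarith [Real.add_one_le_exp (1 / (m : ℝ))]
      _ = Real.exp 1 := by
          rw [← Real.exp_nat_mul]; congr 1; field_simp
  exact one_div_le_one_div_of_le (by positivity) h2

/-! ### The bounds of part (i) -/

section
variable {d : ℕ} (μ : Measure (EuclideanSpace ℝ (Fin d))) [IsProbabilityMeasure μ]

theorem expectedMissedMass_bounds {n : ℕ} (hn : 2 ≤ n) :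
    (1 / 4 : ℝ) * closedWetMeasure μ (1 / n) ≤ expectedMissedMass μ n ∧
      expectedMissedMass μ n ≤
        closedWetMeasure μ (((d : ℝ) + 2) * (Real.log n / n)) + hullError d n / n := by
  have hn2 : (2 : ℝ) ≤ n := by exact_mod_cast hn
  have hn0 : (0 : ℝ) < n := by linarith
  rw [expectedMissedMass_eq μ (by omega)]
  constructor
  · refine le_trans ?_ (one_sub_pow_mul_closedWetMeasure_le μ (t := 1 / n) ?_ n)
    · exact mul_le_mul_of_nonneg_right (one_div_four_le_one_sub_one_div_pow hn) measureReal_nonneg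
    · rw [div_le_one hn0]; linarith
  · have ht : 0 ≤ ((d : ℝ) + 2) * (Real.log n / n) := by
      have := Real.log_nonneg (by linarith : (1 : ℝ) ≤ n)
      positivity
    refine (integral_escapeProb_le μ _ ht n).trans (add_le_add_right ?_ _)
    unfold hullError
    rw [mul_div_cancel_left₀ _ hn0.ne']
    refine mul_le_mul_of_nonneg_left ?_ (by positivity)
    -- `hullError` is tailored to samples of size n - 1, whose exponent is the smaller one.
    exact pow_le_pow_of_le_one (Real.exp_pos _).le (Real.exp_le_one_iff.2 (by linarith)) (by omega)

theorem expectedBoundaryCount_bounds {n : ℕ} (hn : 2 ≤ n) :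
    (1 / Real.exp 1) * n * closedWetMeasure μ (1 / n) ≤ expectedBoundaryCount μ n ∧
      expectedBoundaryCount μ n ≤
        n * closedWetMeasure μ (((d : ℝ) + 2) * (Real.log n / n)) + hullError d n := by
  obtain ⟨m, rfl⟩ : ∃ m, n = m + 1 := ⟨n - 1, by omega⟩
  have hn2 : (2 : ℝ) ≤ (m + 1 : ℕ) := by exact_mod_cast hn
  have hn0 : (0 : ℝ) < (m + 1 : ℕ) := by linarith
  rw [expectedBoundaryCount_eq]
  have hcast : ((m : ℝ) + 1) = (m + 1 : ℕ) := by push_cast; rfl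
  rw [hcast]
  constructor
  · have h1 := one_sub_pow_mul_closedWetMeasure_le μ (t := 1 / (m + 1 : ℕ))
      (by rw [div_le_one hn0]; linarith) m
    have h2 : 1 / Real.exp 1 * closedWetMeasure μ (1 / (m + 1 : ℕ)) ≤
        ∫ z, escapeProb μ m z ∂μ :=
      (mul_le_mul_of_nonneg_right (one_div_exp_one_le_one_sub_one_div_pow (by omega))
        measureReal_nonneg).trans h1
    calc _ = ((m + 1 : ℕ) : ℝ) * (1 / Real.exp 1 * closedWetMeasure μ (1 / (m + 1 : ℕ))) := by
          ring
      _ ≤ _ := mul_le_mul_of_nonneg_left h2 hn0.le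
  · have ht : 0 ≤ ((d : ℝ) + 2) * (Real.log (m + 1 : ℕ) / (m + 1 : ℕ)) := by
      have := Real.log_nonneg (by linarith : (1 : ℝ) ≤ (m + 1 : ℕ))
      positivity
    have h1 := integral_escapeProb_le μ _ ht m
    refine (mul_le_mul_of_nonneg_left h1 hn0.le).trans ?_
    rw [mul_add]
    refine add_le_add_right ?_ _
    unfold hullError
    refine mul_le_mul_of_nonneg_left ?_ hn0.le
    rw [Nat.add_sub_cancel]
    gcongr
    exact Nat.le_succ m

end

/-! ### The measure on concentric circles -/

/-- The function on `[0, 1]` whose superlevel set `{k ≤ ringLevel s}` has length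
`2 ^ (-3 ^ k)` for `k ≥ 1`. -/
noncomputable def ringLevel (s : ℝ) : ℕ := Nat.log 3 (Nat.log 2 ⌊s⁻¹⌋₊)

/-- The mass `2 ^ (-3 ^ k)` of the levels from `k` on. -/
noncomputable def ringTail (k : ℕ) : ℝ := ((2 : ℝ) ^ 3 ^ k)⁻¹

theorem ringTail_pos (k : ℕ) : 0 < ringTail k := by unfold ringTail; positivity

theorem ringTail_le_one (k : ℕ) : ringTail k ≤ 1 :=
  inv_le_one_of_one_le₀ (one_le_pow₀ one_le_two)

theorem ringTail_succ (k : ℕ) : ringTail (k + 1) = ringTail k ^ 3 := by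
  unfold ringTail
  rw [inv_pow, ← pow_mul, pow_succ]

theorem le_ringLevel_iff {k : ℕ} (hk : 1 ≤ k) (s : ℝ) :
    k ≤ ringLevel s ↔ 0 < s ∧ s ≤ ringTail k := by
  have h3 : ∀ y, k ≤ Nat.log 3 y ↔ 3 ^ k ≤ y := by
    intro y
    rcases eq_or_ne y 0 with rfl | hy
    -- `Nat.log 3 0 = 0`, so this case fails for k = 0.
    · simp; omega
    · exact Nat.le_log_iff_pow_le (by norm_num) hy
  have h2 : ∀ y, 3 ^ k ≤ Nat.log 2 y ↔ 2 ^ 3 ^ k ≤ y := by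
    intro y
    rcases eq_or_ne y 0 with rfl | hy
    · simp
    · exact Nat.le_log_iff_pow_le (by norm_num) hy
  unfold ringLevel
  rw [h3, h2]
  rcases le_or_gt s 0 with hs | hs
  · have : ⌊s⁻¹⌋₊ = 0 := Nat.floor_of_nonpos (inv_nonpos.2 hs)
    simp [this, hs.not_gt]
  · rw [Nat.le_floor_iff (inv_pos.2 hs).le]
    push_cast
    rw [le_inv_comm₀ (by positivity) hs]
    simp [hs, ringTail]

theorem measurable_ringLevel : Measurable ringLevel :=
  (measurable_from_top (f := fun n : ℕ => Nat.log 3 (Nat.log 2 n))).comp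
    (Nat.measurable_floor.comp measurable_inv)

/-- The point at angle `θ` on the unit circle. -/
noncomputable def circlePoint (θ : ℝ) : EuclideanSpace ℝ (Fin 2) := !₂[Real.cos θ, Real.sin θ]

theorem norm_circlePoint (θ : ℝ) : ‖circlePoint θ‖ = 1 := by
  rw [EuclideanSpace.norm_eq]
  simp [circlePoint, Fin.sum_univ_two]

theorem measurable_circlePoint : Measurable circlePoint := by
  refine Continuous.measurable ((PiLp.continuous_toLp 2 _).comp ?_)
  refine continuous_pi fun i => ?_
  fin_cases i
  · exact Real.continuous_cos
  · exact Real.continuous_sin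

theorem countable_circlePoint_preimage (w : EuclideanSpace ℝ (Fin 2)) :
    (circlePoint ⁻¹' {w}).Countable := by
  rcases (circlePoint ⁻¹' {w}).eq_empty_or_nonempty with h | ⟨ψ, hψ⟩
  · rw [h]; exact Set.countable_empty
  · refine (Set.countable_range fun n : ℤ => ψ + 2 * Real.pi * n).mono fun θ hθ => ?_
    have h : circlePoint θ = circlePoint ψ := Eq.trans hθ (Eq.symm hψ)
    have h0 : Real.cos θ = Real.cos ψ := congrArg (fun x : EuclideanSpace ℝ (Fin 2) => x 0) h
    have h1 : Real.sin θ = Real.sin ψ := congrArg (fun x : EuclideanSpace ℝ (Fin 2) => x 1) h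
    obtain ⟨n, hn⟩ := Real.Angle.angle_eq_iff_two_pi_dvd_sub.1 (Real.Angle.cos_sin_inj h0 h1)
    exact ⟨n, by simp only; linarith⟩

theorem exists_eq_norm_smul_circlePoint (u : EuclideanSpace ℝ (Fin 2)) :
    ∃ φ : ℝ, -Real.pi < φ ∧ φ ≤ Real.pi ∧ u = ‖u‖ • circlePoint φ := by
  set z : ℂ := ⟨u 0, u 1⟩ with hz
  have hn : ‖z‖ = ‖u‖ := by
    rw [EuclideanSpace.norm_eq, Complex.norm_eq_sqrt_sq_add_sq]
    simp [hz, Fin.sum_univ_two]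
  refine ⟨z.arg, Complex.neg_pi_lt_arg z, Complex.arg_le_pi z, ?_⟩
  ext i
  fin_cases i
  · have := Complex.norm_mul_cos_arg z
    rw [hn] at this
    simpa [circlePoint] using this.symm
  · have := Complex.norm_mul_sin_arg z
    rw [hn] at this
    simpa [circlePoint] using this.symm

theorem inner_circlePoint (θ φ : ℝ) :
    inner ℝ (circlePoint φ) (circlePoint θ) = Real.cos (θ - φ) := by
  rw [Real.cos_sub, PiLp.inner_apply]
  simp [circlePoint, Fin.sum_univ_two]

/-- The point on the circle of radius `4 ^ k`, `k = ringLevel s`, at angle `10 v - 5`. -/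
noncomputable def ringPoint (p : unitInterval × unitInterval) : EuclideanSpace ℝ (Fin 2) :=
  (4 : ℝ) ^ ringLevel p.1 • circlePoint (10 * p.2 - 5)

theorem measurable_ringPoint : Measurable ringPoint := by
  have hradius : Measurable fun p : unitInterval × unitInterval => (4 : ℝ) ^ ringLevel p.1 :=
    (measurable_from_top (f := fun n : ℕ => (4 : ℝ) ^ n)).comp
      (measurable_ringLevel.comp (measurable_subtype_coe.comp measurable_fst))
  have hangle : Measurable fun p : unitInterval × unitInterval => 10 * (p.2 : ℝ) - 5 := by
    fun_prop
  exact hradius.smul (measurable_circlePoint.comp hangle)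

theorem norm_ringPoint (p : unitInterval × unitInterval) :
    ‖ringPoint p‖ = 4 ^ ringLevel p.1 := by
  rw [ringPoint, norm_smul, norm_circlePoint]
  simp

/-- A measure on concentric circles, with rapidly decreasing mass on the outer circles. -/
noncomputable def ringMeasure : Measure (EuclideanSpace ℝ (Fin 2)) :=
  (volume : Measure (unitInterval × unitInterval)).map ringPoint

instance : IsProbabilityMeasure ringMeasure :=
  Measure.isProbabilityMeasure_map measurable_ringPoint.aemeasurable

/-- For each fixed level parameter, only countably many angles hit a given point. -/
theorem ringMeasure_singleton (w : EuclideanSpace ℝ (Fin 2)) : ringMeasure {w} = 0 := by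
  have hm := measurable_ringPoint (measurableSet_singleton w)
  rw [ringMeasure, Measure.map_apply measurable_ringPoint (measurableSet_singleton w),
    Measure.volume_eq_prod, Measure.prod_apply hm]
  refine lintegral_eq_zero_of_ae_eq_zero (ae_of_all _ fun s => ?_)
  refine Set.Countable.measure_zero ?_ _
  have hc := countable_circlePoint_preimage (((4 : ℝ) ^ ringLevel s)⁻¹ • w)
  have hinj : Function.Injective fun v : unitInterval => 10 * (v : ℝ) - 5 := by
    intro v v' h
    exact Subtype.ext (by simp only at h; linarith)
  refine (hc.preimage_of_injOn (f := fun v : unitInterval => 10 * (v : ℝ) - 5)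
    hinj.injOn).mono ?_
  intro v hv
  have hv' : ringPoint (s, v) = w := hv
  have : circlePoint (10 * v - 5) = ((4 : ℝ) ^ ringLevel s)⁻¹ • w := by
    rw [← hv', ringPoint, smul_smul, inv_mul_cancel₀ (by positivity), one_smul]
  exact this

theorem ringMeasure_real_preimage {s : Set (EuclideanSpace ℝ (Fin 2))} (hs : MeasurableSet s) :
    ringMeasure.real s = volume.real (ringPoint ⁻¹' s) := by
  rw [measureReal_def, ringMeasure, Measure.map_apply measurable_ringPoint hs]; rfl

/-- `ringTail k` as a point of the unit interval. -/
noncomputable def ringTailPoint (k : ℕ) : unitInterval :=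
  ⟨ringTail k, (ringTail_pos k).le, ringTail_le_one k⟩

theorem ringMeasure_real_norm_ge {k : ℕ} (hk : 1 ≤ k) {r : ℝ} (hr : 4 ^ (k - 1) < r)
    (hr' : r ≤ 4 ^ k) : ringMeasure.real {z | r ≤ ‖z‖} = ringTail k := by
  rw [ringMeasure_real_preimage (measurableSet_le measurable_const measurable_norm)]
  have : ringPoint ⁻¹' {z | r ≤ ‖z‖} = Set.Ioc 0 (ringTailPoint k) ×ˢ Set.univ := by
    ext p
    have h1 : r ≤ 4 ^ ringLevel p.1 ↔ k ≤ ringLevel p.1 := by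
      constructor
      · intro h
        have := (pow_lt_pow_iff_right₀ (by norm_num : (1 : ℝ) < 4)).1 (hr.trans_le h)
        omega
      · intro h
        exact hr'.trans (pow_le_pow_right₀ (by norm_num) h)
    simp only [Set.mem_preimage, Set.mem_ofPred_eq, norm_ringPoint, h1, le_ringLevel_iff hk,
      Set.mem_prod, Set.mem_univ, and_true, Set.mem_Ioc]
    rfl
  rw [this, measureReal_def, Measure.volume_eq_prod, Measure.prod_prod, unitInterval.volume_Ioc]
  simp [ringTailPoint, (ringTail_pos k).le]

/-! ### Wet part and escape probability of the ring measure -/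

theorem le_ringMeasure_real_halfspace {k : ℕ} (hk : 1 ≤ k) {h : Set (EuclideanSpace ℝ (Fin 2))}
    (hh : IsClosedHalfspace h) {w : EuclideanSpace ℝ (Fin 2)} (hw : w ∈ h)
    (hwk : ‖w‖ ≤ 4 ^ k / 2) : (ringTail k - ringTail (k + 1)) / 10 ≤ ringMeasure.real h := by
  rw [ringMeasure_real_preimage hh.measurableSet]
  obtain ⟨u, c, hu, rfl⟩ := hh
  obtain ⟨φ, hφ1, hφ2, hφ⟩ := exists_eq_norm_smul_circlePoint (-u)
  rw [norm_neg] at hφ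
  have hπ : Real.pi < 4 := Real.pi_lt_four
  -- The arc of angles [φ, φ+1] fits in [-5, 5] because π < 4, and takes a tenth of the range of
  -- `v`. On it cos x ≥ 1 - x²/2 ≥ 1/2.
  let a : unitInterval := ⟨(φ + 5) / 10, by constructor <;> linarith⟩
  let b : unitInterval := ⟨(φ + 6) / 10, by constructor <;> linarith⟩
  have hsub : Set.Ioc (ringTailPoint (k + 1)) (ringTailPoint k) ×ˢ Set.Icc a b ⊆
      ringPoint ⁻¹' {x | inner ℝ u x ≤ c} := by
    rintro ⟨s, v⟩ ⟨⟨hs1, hs2⟩, hv1, hv2⟩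
    have hs1' : ringTail (k + 1) < s := hs1
    have hs2' : s ≤ ringTail k := hs2
    have hv1' : (φ + 5) / 10 ≤ v := hv1
    have hv2' : v ≤ (φ + 6) / 10 := hv2
    have hlev : ringLevel s = k := by
      have h1 := (le_ringLevel_iff hk s).2 ⟨(ringTail_pos _).trans hs1', hs2'⟩
      have h2 := mt (le_ringLevel_iff (k := k + 1) (by omega) s).1
        (fun h => hs1'.not_ge h.2)
      omega
    have hcos : 1 / 2 ≤ Real.cos (10 * v - 5 - φ) := by
      have := Real.one_sub_sq_div_two_le_cos (x := 10 * v - 5 - φ)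
      nlinarith
    have h1 : inner ℝ u (ringPoint (s, v)) = -(4 ^ k * (‖u‖ * Real.cos (10 * v - 5 - φ))) := by
      have : u = -(‖u‖ • circlePoint φ) := by rw [← hφ, neg_neg]
      rw [ringPoint, hlev, real_inner_smul_right]
      conv_lhs => rw [this]
      rw [inner_neg_left, real_inner_smul_left, inner_circlePoint]
      ring
    have h2 : -(‖u‖ * (4 ^ k / 2)) ≤ inner ℝ u w := by
      have := neg_le_of_abs_le (abs_real_inner_le_norm u w)
      have h3 : ‖u‖ * ‖w‖ ≤ ‖u‖ * (4 ^ k / 2) := by gcongr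
      linarith
    have h4 : inner ℝ u w ≤ c := hw
    have h5 : (4 : ℝ) ^ k * ‖u‖ * (1 / 2) ≤ 4 ^ k * ‖u‖ * Real.cos (10 * v - 5 - φ) := by gcongr
    change inner ℝ u (ringPoint (s, v)) ≤ c
    rw [h1]
    linarith
  refine le_trans (le_of_eq ?_) (measureReal_mono hsub)
  have hq : ringTail (k + 1) ≤ ringTail k := by
    rw [ringTail_succ]
    exact pow_le_of_le_one (ringTail_pos k).le (ringTail_le_one k) (by norm_num)
  rw [measureReal_def, Measure.volume_eq_prod, Measure.prod_prod, unitInterval.volume_Ioc,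
    unitInterval.volume_Icc, ENNReal.toReal_mul, ENNReal.toReal_ofReal, ENNReal.toReal_ofReal]
  · simp only [ringTailPoint, a, b]; ring
  · simp only [a, b]; linarith
  · simp only [ringTailPoint]; linarith

theorem closedWetMeasure_ringMeasure_le {k : ℕ} (hk : 1 ≤ k) {t : ℝ}
    (ht : t < (ringTail k - ringTail (k + 1)) / 10) :
    closedWetMeasure ringMeasure t ≤ ringTail k := by
  have h4 : (4 : ℝ) ^ k = 4 * 4 ^ (k - 1) := by
    rw [← pow_succ']; congr 1; omega
  have hp : (0 : ℝ) < 4 ^ (k - 1) := by positivity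
  rw [← ringMeasure_real_norm_ge hk (r := 4 ^ k / 2) (by linarith) (by linarith)]
  refine measureReal_mono (closure_minimal ?_ (isClosed_le continuous_const continuous_norm))
  rintro w ⟨h, hh, hw, hμ⟩
  by_contra hlt
  exact absurd (le_ringMeasure_real_halfspace hk hh hw (not_le.1 hlt).le) (by linarith)

theorem le_integral_escapeProb_ringMeasure {k : ℕ} (hk : 1 ≤ k) (m : ℕ) :
    ringTail k * (1 - m * ringTail (k + 1)) ≤ ∫ z, escapeProb ringMeasure m z ∂ringMeasure := by
  have hS : MeasurableSet {z : EuclideanSpace ℝ (Fin 2) | (4 : ℝ) ^ k ≤ ‖z‖} :=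
    measurableSet_le measurable_const measurable_norm
  have hq1 := ringTail_le_one (k + 1)
  have hesc : ∀ z ∈ {z : EuclideanSpace ℝ (Fin 2) | (4 : ℝ) ^ k ≤ ‖z‖},
      1 - m * ringTail (k + 1) ≤ escapeProb ringMeasure m z := by
    intro z hz
    replace hz : (4 : ℝ) ^ k ≤ ‖z‖ := hz
    have hT : MeasurableSet {z : EuclideanSpace ℝ (Fin 2) | (4 : ℝ) ^ (k + 1) ≤ ‖z‖} :=
      measurableSet_le measurable_const measurable_norm
    have h1 : ringMeasure.real {z : EuclideanSpace ℝ (Fin 2) | (4 : ℝ) ^ (k + 1) ≤ ‖z‖} =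
        ringTail (k + 1) :=
      ringMeasure_real_norm_ge (by omega)
        (pow_lt_pow_right₀ (by norm_num) (by omega)) le_rfl
    have hlev : ∀ᵐ y ∂ringMeasure, ‖y‖ < 4 ^ (k + 1) → ‖y‖ ≤ 4 ^ k := by
      rw [ringMeasure, ae_map_iff measurable_ringPoint.aemeasurable]
      · refine ae_of_all _ fun p hp => ?_
        rw [norm_ringPoint] at hp ⊢
        have := (pow_lt_pow_iff_right₀ (by norm_num : (1 : ℝ) < 4)).1 hp
        exact pow_le_pow_right₀ (by norm_num) (by omega)
      · simp only [imp_iff_not_or, not_lt]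
        exact hT.union (measurableSet_le measurable_norm measurable_const)
    have h2 : 1 - ringTail (k + 1) ≤
        ringMeasure.real {y : EuclideanSpace ℝ (Fin 2) | ‖y‖ ≤ 4 ^ k} := by
      rw [← h1, ← probReal_compl_eq_one_sub hT]
      refine ENNReal.toReal_mono (measure_ne_top _ _) (measure_mono_ae ?_)
      filter_upwards [hlev] with y hy hyT
      exact hy (not_le.1 hyT)
    have h3 := one_add_mul_le_pow (a := -ringTail (k + 1)) (by linarith) m
    calc 1 - m * ringTail (k + 1) ≤ (1 - ringTail (k + 1)) ^ m := by
          rw [sub_eq_add_neg 1 (ringTail (k + 1))]; linarith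
      _ ≤ ringMeasure.real {y : EuclideanSpace ℝ (Fin 2) | ‖y‖ ≤ 4 ^ k} ^ m :=
          pow_le_pow_left₀ (by linarith) h2 m
      _ = _ := (sampleLaw_real_forall_mem ringMeasure m _).symm
      _ ≤ escapeProb ringMeasure m z := by
          refine measureReal_mono fun x hx => ?_
          have hz0 : 0 < ‖z‖ := lt_of_lt_of_le (by positivity) hz
          -- The tangent at `z` to its circle supports every sample of norm at most ‖z‖.
          refine mem_supportedPairs_of_ne_zero (u := -z)
            (neg_ne_zero.2 (norm_pos_iff.1 hz0)) fun i => ?_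
          have hxi : ‖x i‖ ≤ ‖z‖ := le_trans (hx i) hz
          rw [inner_neg_left, inner_sub_right, real_inner_self_eq_norm_sq]
          nlinarith [real_inner_le_norm z (x i), mul_le_mul_of_nonneg_left hxi hz0.le]
  calc ringTail k * (1 - m * ringTail (k + 1)) =
        ∫ z, {z : EuclideanSpace ℝ (Fin 2) | (4 : ℝ) ^ k ≤ ‖z‖}.indicator
          (fun _ => 1 - m * ringTail (k + 1)) z ∂ringMeasure := by
        rw [integral_indicator hS, setIntegral_const, smul_eq_mul,
          ringMeasure_real_norm_ge hk (pow_lt_pow_right₀ (by norm_num) (by omega)) le_rfl]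
    _ ≤ _ := by
        refine integral_mono ((integrable_const _).indicator hS) (integrable_escapeProb _ m)
          fun z => ?_
        by_cases hz : z ∈ {z : EuclideanSpace ℝ (Fin 2) | (4 : ℝ) ^ k ≤ ‖z‖}
        · simpa only [Set.indicator_of_mem hz] using hesc z hz
        · rw [Set.indicator_of_notMem hz]; exact measureReal_nonneg

theorem forty_mul_lt_two_pow {a : ℕ} (ha : 9 ≤ a) : 40 * a < 2 ^ a := by
  induction a, ha using Nat.le_induction with
  | base => norm_num
  | succ a ha ih => rw [pow_succ]; omega

theorem ringMeasure_lower_bounds {k : ℕ} (hk : 2 ≤ k) :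
    expectedMissedMass ringMeasure (4 ^ 3 ^ k) >
        (1 / 2 : ℝ) * closedWetMeasure ringMeasure
          (Real.logb 2 ((4 ^ 3 ^ k : ℕ) : ℝ) / ((4 ^ 3 ^ k : ℕ) : ℝ)) ∧
      expectedBoundaryCount ringMeasure (4 ^ 3 ^ k) >
        (1 / 2 : ℝ) * ((4 ^ 3 ^ k : ℕ) : ℝ) * closedWetMeasure ringMeasure
          (Real.logb 2 ((4 ^ 3 ^ k : ℕ) : ℝ) / ((4 ^ 3 ^ k : ℕ) : ℝ)) := by
  have ha : 9 ≤ 3 ^ k := (by norm_num : 9 ≤ 3 ^ 2).trans (Nat.pow_le_pow_right (by norm_num) hk)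
  set n : ℕ := 4 ^ 3 ^ k with hn
  have hq0 := ringTail_pos k
  have h40 : 40 * ((3 ^ k : ℕ) : ℝ) * ringTail k < 1 := by
    have h1 : (40 * ((3 ^ k : ℕ) : ℝ)) < 2 ^ 3 ^ k := by exact_mod_cast forty_mul_lt_two_pow ha
    have h2 : (2 : ℝ) ^ 3 ^ k * ringTail k = 1 := mul_inv_cancel₀ (by positivity)
    rw [← h2]
    exact mul_lt_mul_of_pos_right h1 hq0
  have ha' : (9 : ℝ) ≤ ((3 ^ k : ℕ) : ℝ) := by exact_mod_cast ha
  have hqs : ringTail k < 1 / 360 := by nlinarith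
  have hnq : (n : ℝ) * ringTail k ^ 2 = 1 := by
    have : (n : ℝ) = (2 ^ 3 ^ k) ^ 2 := by
      rw [hn, ← pow_mul, mul_comm, pow_mul]; push_cast; norm_num
    rw [this, ← mul_pow, ringTail, mul_inv_cancel₀ (by positivity), one_pow]
  have hn0 : (0 : ℝ) < n := by rw [hn]; positivity
  have hlog : Real.logb 2 (n : ℝ) = 2 * ((3 ^ k : ℕ) : ℝ) := by
    have : (n : ℝ) = 2 ^ (2 * 3 ^ k) := by rw [hn, pow_mul]; push_cast; norm_num
    rw [this, Real.logb_pow, Real.logb_self_eq_one (by norm_num)]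
    push_cast; ring
  -- With q = `ringTail k` this reads 20 · 3^k q < 1 - q², and `h40` makes the left side less than
  -- 1/2.
  have ht : Real.logb 2 (n : ℝ) / n < (ringTail k - ringTail (k + 1)) / 10 := by
    rw [hlog, div_lt_iff₀ hn0, ringTail_succ]
    have h1 : (ringTail k - ringTail k ^ 3) / 10 * n =
        (n * ringTail k ^ 2) * (1 - ringTail k ^ 2) / (10 * ringTail k) := by
      field_simp
    rw [h1, hnq, lt_div_iff₀ (by positivity)]
    nlinarith
  have hwet := closedWetMeasure_ringMeasure_le (by omega : 1 ≤ k) ht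
  -- Needed for m = n (missed mass) and m = n - 1 (boundary count).
  have hE : ∀ m : ℕ, m ≤ n →
      1 / 2 * ringTail k < ∫ z, escapeProb ringMeasure m z ∂ringMeasure := by
    intro m hm
    refine lt_of_lt_of_le ?_ (le_integral_escapeProb_ringMeasure (by omega : 1 ≤ k) m)
    have h1 : (m : ℝ) * ringTail (k + 1) ≤ ringTail k := by
      calc (m : ℝ) * ringTail (k + 1) ≤ n * ringTail (k + 1) := by
            have := (ringTail_pos (k + 1)).le
            gcongr
        _ = (n * ringTail k ^ 2) * ringTail k := by rw [ringTail_succ]; ring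
        _ = ringTail k := by rw [hnq, one_mul]
    nlinarith
  have hnpos : 0 < n := by positivity
  constructor
  · rw [gt_iff_lt, expectedMissedMass_eq _ hnpos]
    exact lt_of_le_of_lt (by linarith) (hE n le_rfl)
  · obtain ⟨m, hm⟩ : ∃ m, n = m + 1 := ⟨n - 1, by omega⟩
    have h1 := hE m (by omega)
    have h2 : expectedBoundaryCount ringMeasure n =
        n * ∫ z, escapeProb ringMeasure m z ∂ringMeasure := by
      rw [hm, expectedBoundaryCount_eq]; push_cast; rfl
    rw [gt_iff_lt, h2, mul_comm (1 / 2 : ℝ) (n : ℝ), mul_assoc]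
    refine mul_lt_mul_of_pos_left (lt_of_le_of_lt ?_ h1) hn0
    linarith

theorem theorem5 :
    (∀ d : ℕ, ∃ ε : ℕ → ℝ, Tendsto ε atTop (𝓝 0) ∧
      ∀ (μ : Measure (EuclideanSpace ℝ (Fin d))), IsProbabilityMeasure μ → ∀ n : ℕ, 2 ≤ n →
        (Integrable (fun x : Fin n → EuclideanSpace ℝ (Fin d) => missedMass μ x) (sampleLaw μ n) ∧
          (1 / 4 : ℝ) * closedWetMeasure μ (1 / n) ≤ expectedMissedMass μ n ∧
          expectedMissedMass μ n ≤
            closedWetMeasure μ (((d : ℝ) + 2) * (Real.log n / n)) + ε n / n) ∧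
        (Integrable (fun x : Fin n → EuclideanSpace ℝ (Fin d) => (boundaryCount x : ℝ))
            (sampleLaw μ n) ∧
          (1 / Real.exp 1) * n * closedWetMeasure μ (1 / n) ≤ expectedBoundaryCount μ n ∧
          expectedBoundaryCount μ n ≤
            n * closedWetMeasure μ (((d : ℝ) + 2) * (Real.log n / n)) + ε n)) ∧
    (∃ ν : Measure (EuclideanSpace ℝ (Fin 2)), IsProbabilityMeasure ν ∧ (∀ p, ν {p} = 0) ∧
      ∃ᶠ n : ℕ in atTop,
        expectedMissedMass ν n > (1 / 2 : ℝ) * closedWetMeasure ν (Real.logb 2 n / n) ∧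
        expectedBoundaryCount ν n >
          (1 / 2 : ℝ) * n * closedWetMeasure ν (Real.logb 2 n / n)) := by
  refine ⟨fun d => ⟨hullError d, tendsto_hullError d, fun μ _ n hn => ⟨⟨?_, ?_⟩, ⟨?_, ?_⟩⟩⟩,
    ringMeasure, inferInstance, ringMeasure_singleton, ?_⟩
  · exact integrable_missedMass μ (by omega)
  · exact expectedMissedMass_bounds μ hn
  · obtain ⟨m, rfl⟩ : ∃ m, n = m + 1 := ⟨n - 1, by omega⟩
    exact integrable_boundaryCount μ m
  · exact expectedBoundaryCount_bounds μ hn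
  · rw [frequently_atTop]
    intro N
    refine ⟨4 ^ 3 ^ (N + 2), ?_, ringMeasure_lower_bounds (by omega)⟩
    have h1 : N + 2 < 3 ^ (N + 2) := Nat.lt_pow_self (by norm_num)
    have h2 : 3 ^ (N + 2) < 4 ^ 3 ^ (N + 2) := Nat.lt_pow_self (by norm_num)
    omega
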